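/- **Setting.** A Tanner graph consists of a finite set $V$ of variable nodes, a finite set $C$ of check nodes and a neighbourhood $N(c)\subseteq V$ for each $c\in C$. Let $\zeta_c$ be the set of $z\in\{0,1\}^V$ for which $\sum_{v\in N(c)}z_v$ is even, and let $P=\bigcap_{c\in C}\operatorname{conv}(\zeta_c)\subseteq\mathbb R^V$ be the fundamental polytope. For an error pattern $\eta\in\{0,1\}^V$ (with the all-zeros codeword transmitted), LP decoding succeeds if $0$ is the unique minimizer over $P$ of $\sum_{v}(-1)^{\eta_v}x_v$; otherwise there is an LP error. On the $\epsilon$-BSC, $0<\epsilon<1/2$, the bits $\eta_v$ are independent and equal to $1$ with probability $\epsilon$. An ensemble is a probability distribution over codes (given by their Tanner graphs). The LP threshold on the BSC of a sequence $(\Gamma_t)_{t\in\mathbb N}$ of ensembles is $$\xi=\sup\Big\{\epsilon\in(0,\tfrac12)\ :\ \Pr_{\zeta\sim\Gamma_t,\ \epsilon\text{-BSC}}[\text{LP error on }\zeta]=o(1)\text{ as }t\to\infty\Big\},\qquad \sup\emptyset=0 .$$ Let $d_v\ge 3$ be odd, $k\ge 2$, $d_c=kd_v$ and $\hat d_v=(d_v-1)/2$.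 For $L\ge 0$ and $M\geq 1$ divisible by $k$, a $(d_v,d_c,L,M)$ graph cover code has $M$ variable nodes and $Md_v/d_c=M/k$ check nodes at each position of $[-L:L]$, positions being taken modulo $2L+1$, such that (i) a check node at position $j$ is joined to exactly $k$ variable nodes at position $j+i$ for every $i\in[-\hat d_v:\hat d_v]$, and to no other variable nodes; (ii) no two check nodes at the same position are joined to the same variable node. Cutting such a code $\zeta$ at position $i$ means removing all variable nodes at the positions $i+j$, $j\in[0:2\hat d_v-1]$, with their edges; the result is the derived spatially coupled code $\zeta'_i$. **Theorem.** Let $d_v\ge 3$ be odd, $k\ge 2$ and $d_c=kd_v$. There is $\nu>0$, depending only on $d_v$ and $d_c$, with the following property. Let $L=L_t\to\infty$, let $M=M_t\ge 1$ be divisible by $k$, and for each $t$ let $\Gamma_{GC}=\Gamma_{GC,t}$ be an arbitrary probability distribution over $(d_v,d_c,L,M)$ graph cover codes. Let $\Gamma_{SC}$ be the ensemble sampled by drawing $\zeta\sim\Gamma_{GC}$ and returning $\zeta'_i$ for an independent, uniformly random position $i\in[-L:L]$. Let $\xi_{GC}$ and $\xi_{SC}$ be the LP thresholds of $\Gamma_{GC}$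 and $\Gamma_{SC}$ on the BSC. If $M=o(L^{\nu})$ and, for every constant $\Delta$ with $0<\Delta<\xi_{SC}$, $$\Pr_{\zeta'\sim\Gamma_{SC},\ (\xi_{SC}-\Delta)\text{-BSC}}[\text{LP error on }\zeta']=o\!\left(\frac1{L^2}\right),$$ then $\xi_{GC}=\xi_{SC}$. -/

import Mathlib

/-- A finite Tanner graph: variable nodes `V`, check nodes `C`, and for every check node `c`
the set `nbr c` of the variable nodes joined to it.  -/
structure TannerGraph where
  V : Type
  C : Type
  [fintypeV : Fintype V]
  [fintypeC : Fintype C]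
  nbr : C → Finset V

namespace TannerGraph

attribute [instance] fintypeV fintypeC

/-- The 0/1 vectors that satisfy the single parity check `c`. -/
def localCode (T : TannerGraph) (c : T.C) : Set (T.V → ℝ) :=
  {z | (∀ v, z v = 0 ∨ z v = 1) ∧ Even {v : T.V | v ∈ T.nbr c ∧ z v = 1}.ncard}

/-- The fundamental polytope: the intersection of the convex hulls of the local codes. -/
def fundamentalPolytope (T : TannerGraph) : Set (T.V → ℝ) :=
  ⋂ c : T.C, convexHull ℝ (T.localCode c)

/-- The normalized log-likelihood ratios on the BSC when the all-zeros codeword is sent and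
`η` is the error pattern (`true` is a flipped bit). -/
def llr (T : TannerGraph) (η : T.V → Bool) (v : T.V) : ℝ :=
  if η v then -1 else 1

/-- The objective function of the decoding linear program. -/
def lpCost (T : TannerGraph) (η : T.V → Bool) (x : T.V → ℝ) : ℝ :=
  ∑ v, T.llr η v * x v

/-- LP decoding succeeds for `η`: the zero codeword is the unique optimal solution. -/
def LPSuccess (T : TannerGraph) (η : T.V → Bool) : Prop :=
  {x | x ∈ T.fundamentalPolytope ∧ IsMinOn (T.lpCost η) T.fundamentalPolytope x} = {0}

open Classical in
/-- The probability that LP decoding fails on `T` over the BSC with crossover probability `ε`. -/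
noncomputable def lpErrorProb (T : TannerGraph) (ε : ℝ) : ℝ :=
  ∑ η : T.V → Bool, if T.LPSuccess η then 0 else ∏ v, (if η v then ε else 1 - ε)

end TannerGraph

/-- The LP error probability of an ensemble (a probability distribution over codes, each given
by its Tanner graph) on the BSC with crossover probability `ε`. -/
noncomputable def ensembleErrorProb (Γ : PMF TannerGraph) (ε : ℝ) : ℝ :=
  ∑' T : TannerGraph, (Γ T).toReal * T.lpErrorProb ε

/-- The LP threshold on the BSC of a sequence of ensembles: the supremum of the crossover
probabilities at which the LP error probability is `o(1)` along the sequence.  The set is bounded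
above; if it is empty, the value is `0`. -/
noncomputable def lpThreshold (Γ : ℕ → PMF TannerGraph) : ℝ :=
  sSup {ε : ℝ | 0 < ε ∧ ε < 1 / 2 ∧
    (fun t => ensembleErrorProb (Γ t) ε) =o[Filter.atTop] (fun _ => (1 : ℝ))}

/-- A `(d_v, d_c = k d_v, L, M)` graph cover code.  The positions `[-L : L]`, with arithmetic
`mod [-L : L]`, are the elements of `ZMod (2 * L + 1)`; there are `M` variable nodes and
`M d_v / d_c = M / k` check nodes at each position, and `(d_v - 1) / 2` is the half-width of the
window of positions that a check node sees. -/
structure GraphCoverCode (dv k L M : ℕ) where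
  nbr : ZMod (2 * L + 1) × Fin (M / k) → Finset (ZMod (2 * L + 1) × Fin M)
  /-- A check node is joined only to variable nodes at positions in its window. -/
  window : ∀ c, ∀ v ∈ nbr c,
    ∃ i ∈ Finset.Icc (-(((dv - 1) / 2 : ℕ) : ℤ)) (((dv - 1) / 2 : ℕ) : ℤ),
      v.1 = c.1 + (i : ZMod (2 * L + 1))
  /-- A check node is joined to exactly `k` variable nodes at each position in its window. -/
  card_window : ∀ c,
    ∀ i ∈ Finset.Icc (-(((dv - 1) / 2 : ℕ) : ℤ)) (((dv - 1) / 2 : ℕ) : ℤ),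
      ((nbr c).filter fun v => v.1 = c.1 + (i : ZMod (2 * L + 1))).card = k
  /-- No two check nodes at the same position are joined to the same variable node. -/
  disjoint : ∀ c c', c ≠ c' → c.1 = c'.1 → Disjoint (nbr c) (nbr c')

namespace GraphCoverCode

variable {dv k L M : ℕ}

/-- The Tanner graph of a graph cover code. -/
def toTanner (ζ : GraphCoverCode dv k L M) : TannerGraph where
  V := ZMod (2 * L + 1) × Fin M
  C := ZMod (2 * L + 1) × Fin (M / k)
  nbr := ζ.nbr

/-- The derived spatially coupled code with cut position `i`: all variable nodes at the positions
`i, i + 1, …, i + (d_v - 2)` and their edges are removed; all check nodes stay. -/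
def cut (ζ : GraphCoverCode dv k L M) (i : ZMod (2 * L + 1)) : TannerGraph where
  V := {v : ZMod (2 * L + 1) × Fin M //
    ∀ j ∈ Finset.range (2 * ((dv - 1) / 2)), v.1 ≠ i + (j : ZMod (2 * L + 1))}
  C := ZMod (2 * L + 1) × Fin (M / k)
  nbr c := (ζ.nbr c).subtype _

end GraphCoverCode

/-- The distribution over codes that belongs to a distribution over graph cover codes. -/
noncomputable def coverEnsemble {dv k L M : ℕ} (Γ : PMF (GraphCoverCode dv k L M)) :
    PMF TannerGraph :=
  Γ.map GraphCoverCode.toTanner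

/-- The derived spatially coupled ensemble: draw a graph cover code and cut it at a uniformly
random position. -/
noncomputable def coupledEnsemble {dv k L M : ℕ} (Γ : PMF (GraphCoverCode dv k L M)) :
    PMF TannerGraph :=
  Γ.bind fun ζ => (PMF.uniformOfFintype (ZMod (2 * L + 1))).map ζ.cut

/-! By convexity and homogeneity, LP decoding succeeds exactly when the cost is positive on the
nonzero vectors of the fundamental cone. Given a cone vector of the cover code and a cut, raise
the coordinates near the cut to a common value, their total weight, and set the removed ones to
zero: the result is a cone vector of the cut code, and it differs from the original by `O(M)`
times the weight near the cut. Averaging over all cuts, each coordinate is near few of them, so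
the cost on the cover code is at least minus the total weight times the fraction of failing cut
codes plus `O(M / L)`.

Flip each remaining bit with a further probability `β`. If decoding of the cover code fails,
some nonzero cone vector has nonpositive cost, and the extra flips lower its expected cost by
at least `β` times its weight. So on average at least a fraction `β - O(M / L)` of the cut
codes fails after the extra flips: vanishing error of the coupled ensemble at `ε + (1 - ε) β`
forces vanishing error of the cover ensemble at `ε`. Conversely a cut code only restricts the
cone, so cutting never hurts. -/

open Filter Finset Topology
open scoped BigOperators

theorem sum_mul_le_half_mul_sum {ι : Type*} {s : Finset ι} {g x : ι → ℝ} {a : ℝ}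
    (hx : ∀ v ∈ s, 0 ≤ x v) (hcone : ∀ v ∈ s, 2 * x v ≤ ∑ u ∈ s, x u)
    (hg : ∀ u ∈ s, ∀ v ∈ s, u ≠ v → g u + g v ≤ a) :
    ∑ v ∈ s, g v * x v ≤ a / 2 * ∑ v ∈ s, x v := by
  classical
  -- At most one coefficient exceeds `a / 2`; the cone inequality at its index pays for the excess.
  by_cases! hbig : ∃ u ∈ s, a / 2 < g u
  · obtain ⟨u, hu, hgu⟩ := hbig
    have hrest : ∑ v ∈ s.erase u, g v * x v ≤ (a - g u) * ∑ v ∈ s.erase u, x v := by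
      rw [mul_sum]
      refine sum_le_sum fun v hv => mul_le_mul_of_nonneg_right ?_ (hx v (mem_of_mem_erase hv))
      linarith [hg u hu v (mem_of_mem_erase hv) (ne_of_mem_erase hv).symm]
    have hu_le := hcone u hu
    rw [← add_sum_erase s x hu] at hu_le ⊢
    rw [← add_sum_erase s (fun v => g v * x v) hu]
    nlinarith
  · rw [mul_sum]
    exact sum_le_sum fun v hv => mul_le_mul_of_nonneg_right (hbig v hv) (hx v hv)

theorem sum_sum_le_mul_sum {ι V : Type*} [Fintype ι] [Fintype V] {B : ι → Finset V} {x : V → ℝ}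
    {m : ℕ} (hx : ∀ v, 0 ≤ x v) (hm : ∀ v, {i | v ∈ B i}.ncard ≤ m) :
    ∑ i, ∑ v ∈ B i, x v ≤ m * ∑ v, x v := by
  classical
  rw [sum_comm' (t' := univ) (s' := fun v => {i | v ∈ B i}) (by simp), mul_sum]
  refine sum_le_sum fun v _ => ?_
  rw [sum_const, nsmul_eq_mul]
  refine mul_le_mul_of_nonneg_right ?_ (hx v)
  have hcard := hm v
  rw [Set.ncard_eq_toFinset_card', Set.toFinset_ofPred] at hcard
  exact_mod_cast hcard

theorem sum_prod_mul_comp {V α β R : Type*} [Fintype V] [DecidableEq V] [Fintype α] [Fintype β]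
    [DecidableEq β] [CommSemiring R] (w : V → α → R) (g : V → α → β) (F : (V → β) → R) :
    ∑ η : V → α, (∏ v, w v (η v)) * F (fun v => g v (η v)) =
      ∑ ξ : V → β, (∏ v, ∑ a with g v a = ξ v, w v a) * F ξ := by
  rw [← sum_fiberwise univ fun (η : V → α) v => g v (η v)]
  refine sum_congr rfl fun ξ _ => ?_
  have hfiber : ({η | (fun v => g v (η v)) = ξ} : Finset (V → α)) =
      Fintype.piFinset fun v => {a | g v a = ξ v} := by
    ext η
    simp [funext_iff]
  rw [hfiber, prod_univ_sum, sum_mul]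
  refine sum_congr rfl fun η hη => ?_
  rw [← hfiber, mem_filter] at hη
  rw [hη.2]

open Classical in
/-- The expectation of `F η` over error patterns `η` of the BSC with crossover probability `ε`: the
bits of `η` are independent and equal to `true` with probability `ε`. -/
noncomputable def bscExp {V : Type*} [Fintype V] (ε : ℝ) (F : (V → Bool) → ℝ) : ℝ :=
  ∑ η : V → Bool, (∏ v, if η v then ε else 1 - ε) * F η

section BscExp

variable {V : Type*} [Fintype V]

theorem bscExp_mono {ε : ℝ} (h0 : 0 ≤ ε) (h1 : ε ≤ 1) {F G : (V → Bool) → ℝ}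
    (h : ∀ η, F η ≤ G η) : bscExp ε F ≤ bscExp ε G := by
  refine sum_le_sum fun η _ => mul_le_mul_of_nonneg_left (h η) (prod_nonneg fun v _ => ?_)
  split_ifs <;> linarith

theorem bscExp_sum {ι : Type*} (s : Finset ι) (ε : ℝ) (F : ι → (V → Bool) → ℝ) :
    bscExp ε (fun η => ∑ i ∈ s, F i η) = ∑ i ∈ s, bscExp ε (F i) := by
  simp only [bscExp, mul_sum]
  exact sum_comm

theorem bscExp_mul_const (ε : ℝ) (F : (V → Bool) → ℝ) (a : ℝ) :
    bscExp ε (fun η => F η * a) = bscExp ε F * a := by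
  simp only [bscExp, sum_mul, mul_assoc]

theorem bscExp_expect {ι : Type*} (s : Finset ι) (ε : ℝ) (F : ι → (V → Bool) → ℝ) :
    bscExp ε (fun η => 𝔼 i ∈ s, F i η) = 𝔼 i ∈ s, bscExp ε (F i) := by
  simp only [expect_eq_sum_div_card, div_eq_mul_inv, bscExp_mul_const, bscExp_sum]

theorem bscExp_add (ε : ℝ) (F G : (V → Bool) → ℝ) :
    bscExp ε (fun η => F η + G η) = bscExp ε F + bscExp ε G := by
  simp only [bscExp, mul_add, sum_add_distrib]

theorem bscExp_prod (ε : ℝ) (g : V → Bool → ℝ) :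
    bscExp ε (fun η => ∏ v, g v (η v)) = ∏ v, (ε * g v true + (1 - ε) * g v false) := by
  classical
  have hbit : ∀ v, ε * g v true + (1 - ε) * g v false =
      ∑ b : Bool, (if b then ε else 1 - ε) * g v b := fun v => by simp
  simp only [hbit, prod_univ_sum, Fintype.piFinset_univ, prod_mul_distrib, bscExp]

theorem bscExp_const (ε a : ℝ) : bscExp (V := V) ε (fun _ => a) = a := by
  have hone : bscExp (V := V) ε (fun _ => 1) = 1 := by
    simpa using bscExp_prod (V := V) ε fun _ _ => 1
  simpa only [one_mul, hone] using bscExp_mul_const (V := V) ε (fun _ => 1) a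

theorem bscExp_apply (ε : ℝ) (v : V) (g : Bool → ℝ) :
    bscExp ε (fun η => g (η v)) = ε * g true + (1 - ε) * g false := by
  classical
  have hprod := bscExp_prod ε fun u b => if u = v then g b else 1
  have hbit : ∀ u, ε * (if u = v then g true else 1) + (1 - ε) * (if u = v then g false else 1) =
      if u = v then ε * g true + (1 - ε) * g false else 1 := fun u => by
    split_ifs <;> ring
  simpa only [hbit, prod_ite_eq', mem_univ, if_true] using hprod

theorem bscExp_bscExp_or (ε β : ℝ) (F : (V → Bool) → ℝ) :
    bscExp ε (fun η => bscExp β fun ω => F fun v => η v || ω v) =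
      bscExp (ε + (1 - ε) * β) F := by
  classical
  have hbit : ∀ b : Bool, (∑ a : Bool × Bool with (a.1 || a.2) = b,
      (if a.1 then ε else 1 - ε) * if a.2 then β else 1 - β) =
        if b then ε + (1 - ε) * β else 1 - (ε + (1 - ε) * β) := by
    intro b
    cases b <;> simp [sum_filter, Fintype.sum_prod_type] <;> ring
  simp only [bscExp, mul_sum, ← mul_assoc, ← prod_mul_distrib, ← hbit]
  rw [← sum_prod_mul_comp (fun _ (a : Bool × Bool) => (if a.1 then ε else 1 - ε) *
      if a.2 then β else 1 - β) (fun _ a => a.1 || a.2) F, ← Fintype.sum_prod_type',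
    ← (Equiv.arrowProdEquivProdArrow V (fun _ => Bool) fun _ => Bool).sum_comp]
  rfl

theorem bscExp_comp_subtype_val (ε : ℝ) (p : V → Prop) [DecidablePred p]
    (F : ({v // p v} → Bool) → ℝ) :
    bscExp ε (fun η : V → Bool => F fun v => η v) = bscExp ε F := by
  classical
  have hsplit : ∀ η : {v // p v} → Bool, ∀ ω : {v // ¬ p v} → Bool,
      (∏ v, if (Equiv.piEquivPiSubtypeProd p fun _ => Bool).symm (η, ω) v then ε else 1 - ε) =
        (∏ v, if η v then ε else 1 - ε) * ∏ v, if ω v then ε else 1 - ε := by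
    intro η ω
    rw [← Fintype.prod_subtype_mul_prod_subtype p]
    congr 1 <;> refine prod_congr rfl fun v _ => ?_ <;> simp [v.2]
  have hmass : ∑ ω : {v // ¬ p v} → Bool, ∏ v, (if ω v then ε else 1 - ε) = 1 :=
    (sum_congr (by congr!) fun ω _ => (mul_one _).symm).trans (bscExp_const ε 1)
  unfold bscExp
  rw [← (Equiv.piEquivPiSubtypeProd p fun _ => Bool).symm.sum_comp, Fintype.sum_prod_type]
  refine sum_congr (by congr!) fun η _ => ?_
  have hval : ∀ ω : {v // ¬ p v} → Bool,
      (fun v : {v // p v} => (Equiv.piEquivPiSubtypeProd p fun _ => Bool).symm (η, ω) v) = η :=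
    fun ω => funext fun v => by simp [v.2]
  simp only [hsplit, hval, mul_right_comm, ← mul_sum, hmass, mul_one]

end BscExp

section PMFSums

variable {α β : Type*}

theorem hasSum_toReal_pure_mul (b : β) (g : β → ℝ) :
    HasSum (fun b' => (PMF.pure b b').toReal * g b') (g b) := by
  simpa using hasSum_single (f := fun b' => (PMF.pure b b').toReal * g b') b
    fun b' hb' => by simp [hb']

variable [Fintype α] (p : PMF α)

theorem hasSum_toReal_bind_mul {f : α → PMF β} {g : β → ℝ} {s : α → ℝ}
    (h : ∀ a, HasSum (fun b => (f a b).toReal * g b) (s a)) :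
    HasSum (fun b => (p.bind f b).toReal * g b) (∑ a, (p a).toReal * s a) := by
  have hbind : ∀ b, (p.bind f b).toReal * g b = ∑ a, (p a).toReal * ((f a b).toReal * g b) := by
    intro b
    rw [PMF.bind_apply, tsum_fintype, ENNReal.toReal_sum fun a _ =>
      ENNReal.mul_ne_top (p.apply_ne_top a) ((f a).apply_ne_top b), sum_mul]
    simp only [ENNReal.toReal_mul, mul_assoc]
  simp only [hbind]
  exact hasSum_sum fun a _ => (h a).mul_left _

theorem hasSum_toReal_map_mul (f : α → β) (g : β → ℝ) :
    HasSum (fun b => (p.map f b).toReal * g b) (∑ a, (p a).toReal * g (f a)) :=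
  hasSum_toReal_bind_mul p fun a => hasSum_toReal_pure_mul (f a) g

end PMFSums

namespace TannerGraph

/-- The cone generated by the local code of the check node `c`: nonnegative vectors in which no
coordinate at a neighbor of `c` exceeds the sum of the coordinates at the other neighbors. -/
def localCone (T : TannerGraph) (c : T.C) : ConvexCone ℝ (T.V → ℝ) where
  carrier := {x | (∀ v, 0 ≤ x v) ∧ ∀ v ∈ T.nbr c, 2 * x v ≤ ∑ u ∈ T.nbr c, x u}
  smul_mem' a ha x hx := by
    refine ⟨fun v => mul_nonneg ha.le (hx.1 v), fun v hv => ?_⟩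
    simp only [Pi.smul_apply, smul_eq_mul, ← mul_sum, mul_left_comm 2 a]
    exact mul_le_mul_of_nonneg_left (hx.2 v hv) ha.le
  add_mem' x hx y hy := by
    refine ⟨fun v => add_nonneg (hx.1 v) (hy.1 v), fun v hv => ?_⟩
    simp only [Pi.add_apply, mul_add, sum_add_distrib]
    exact add_le_add (hx.2 v hv) (hy.2 v hv)

/-- The fundamental cone, which agrees with the fundamental polytope near the origin and so decides
whether the origin is the unique minimizer of a linear function on the polytope. Without check nodes
it is the whole space, as is the polytope. -/
def fundamentalCone (T : TannerGraph) : ConvexCone ℝ (T.V → ℝ) :=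
  ⨅ c, T.localCone c

section Polytope

variable (T : TannerGraph)

theorem mem_localCone {c : T.C} {x : T.V → ℝ} :
    x ∈ T.localCone c ↔ (∀ v, 0 ≤ x v) ∧ ∀ v ∈ T.nbr c, 2 * x v ≤ ∑ u ∈ T.nbr c, x u :=
  Iff.rfl

theorem mem_fundamentalCone {x : T.V → ℝ} :
    x ∈ T.fundamentalCone ↔ ∀ c, x ∈ T.localCone c :=
  ConvexCone.mem_iInf

variable {T} in
theorem nonneg_of_mem_fundamentalCone [Nonempty T.C] {x : T.V → ℝ} (hx : x ∈ T.fundamentalCone)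
    (v : T.V) : 0 ≤ x v :=
  (T.mem_fundamentalCone.1 hx (Classical.arbitrary T.C)).1 v

variable {T} in
theorem sum_nbr_eq_ncard {c : T.C} {z : T.V → ℝ} (hz : ∀ v, z v = 0 ∨ z v = 1) :
    ∑ v ∈ T.nbr c, z v = {v | v ∈ T.nbr c ∧ z v = 1}.ncard := by
  classical
  have hset : {v | v ∈ T.nbr c ∧ z v = 1} = ({v ∈ T.nbr c | z v = 1} : Finset T.V) := by
    ext; simp
  rw [hset, Set.ncard_coe_finset, card_filter, Nat.cast_sum]
  refine sum_congr rfl fun v _ => ?_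
  rcases hz v with h | h <;> simp [h]

theorem localCode_subset_localCone (c : T.C) : T.localCode c ⊆ T.localCone c := by
  rintro z ⟨hz, heven⟩
  have hnonneg : ∀ v, 0 ≤ z v := fun v => by rcases hz v with h | h <;> simp [h]
  refine ⟨hnonneg, fun v hv => ?_⟩
  rcases hz v with h | h
  · simpa only [h, mul_zero] using sum_nonneg fun u _ => hnonneg u
  · have hpos : 0 < {v | v ∈ T.nbr c ∧ z v = 1}.ncard := (Set.ncard_pos).2 ⟨v, hv, h⟩
    have htwo : 2 ≤ {v | v ∈ T.nbr c ∧ z v = 1}.ncard := by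
      obtain ⟨r, hr⟩ := heven
      omega
    rw [sum_nbr_eq_ncard hz, h, mul_one]
    exact_mod_cast htwo

theorem fundamentalPolytope_subset_fundamentalCone :
    T.fundamentalPolytope ⊆ T.fundamentalCone := fun _ hx =>
  T.mem_fundamentalCone.2 fun c =>
    convexHull_min (T.localCode_subset_localCone c) (T.localCone c).convex (Set.mem_iInter.1 hx c)

theorem finite_localCode (c : T.C) : (T.localCode c).Finite := by
  refine (Set.Finite.pi' fun _ : T.V => Set.toFinite {(0 : ℝ), 1}).subset ?_
  exact fun z hz v => hz.1 v

variable {T} in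
theorem indicator_one_mem_localCode {c : T.C} {s : Set T.V} (hs : Even (s ∩ T.nbr c).ncard) :
    s.indicator 1 ∈ T.localCode c := by
  classical
  refine ⟨fun v => ?_, ?_⟩
  · rw [Set.indicator_apply]
    split_ifs <;> simp
  · convert hs using 2
    ext v
    simp [Set.indicator_apply, and_comm]

theorem zero_mem_fundamentalPolytope : 0 ∈ T.fundamentalPolytope := by
  refine Set.mem_iInter.2 fun c => subset_convexHull ℝ _ ?_
  rw [← Set.indicator_empty' (1 : T.V → ℝ)]
  exact indicator_one_mem_localCode (by simp)

variable {T} in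
theorem mem_convexHull_localCode {c : T.C} {x : T.V → ℝ} (hx : x ∈ T.localCone c)
    (hsum : ∑ v, x v ≤ 1) : x ∈ convexHull ℝ (T.localCode c) := by
  classical
  -- The vectors `0`, `e_v` for `v ∉ N(c)` and `e_u + e_v` for `u, v ∈ N(c)` lie in the local code,
  -- and their values already bound a separating functional at `x`.
  by_contra hmem
  obtain ⟨f, a, hlt, hax⟩ := geometric_hahn_banach_closed_point (convex_convexHull ℝ _)
    ((T.finite_localCode c).isClosed_convexHull (𝕜 := ℝ)) hmem
  have hind : ∀ s : Set T.V, Even (s ∩ T.nbr c).ncard → f (s.indicator 1) < a := fun s hs =>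
    hlt _ (subset_convexHull ℝ _ (indicator_one_mem_localCode hs))
  set g : T.V → ℝ := fun v => f (Set.indicator {v} 1)
  have hfx : f x = ∑ v, g v * x v := by
    rw [← ContinuousLinearMap.coe_coe, LinearMap.pi_apply_eq_sum_univ]
    refine sum_congr rfl fun v _ => ?_
    rw [smul_eq_mul, mul_comm]
    refine congrArg (f · * x v) (funext fun u => ?_)
    simp [Set.indicator_apply, eq_comm]
  have ha : 0 < a := by
    simpa only [Set.indicator_empty', map_zero] using hind ∅ (by simp)
  have hout : ∀ v ∉ T.nbr c, g v ≤ a := fun v hv => (hind {v} (by simp [hv])).le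
  have hpair : ∀ u ∈ T.nbr c, ∀ v ∈ T.nbr c, u ≠ v → g u + g v ≤ a := by
    intro u hu v hv huv
    have heven : Even (({u} ∪ {v} : Set T.V) ∩ T.nbr c).ncard := by
      rw [Set.inter_eq_left.2 (by simp [Set.insert_subset_iff, hu, hv]), Set.singleton_union,
        Set.ncard_pair huv]
      exact even_two
    have hlt := hind _ heven
    rw [Set.indicator_union_of_disjoint (by simpa using huv)] at hlt
    exact (map_add f _ _).symm.trans_le hlt.le
  have hnbr := sum_mul_le_half_mul_sum (fun v _ => hx.1 v) hx.2 hpair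
  have hcompl : ∑ v ∈ (T.nbr c)ᶜ, g v * x v ≤ a * ∑ v ∈ (T.nbr c)ᶜ, x v := by
    rw [mul_sum]
    exact sum_le_sum fun v hv => mul_le_mul_of_nonneg_right (hout v (mem_compl.1 hv)) (hx.1 v)
  have hnonneg : 0 ≤ ∑ v ∈ T.nbr c, x v := sum_nonneg fun v _ => hx.1 v
  rw [hfx, ← sum_add_sum_compl (T.nbr c)] at hax
  rw [← sum_add_sum_compl (T.nbr c)] at hsum
  nlinarith

variable {T} in
theorem exists_pos_smul_mem_fundamentalPolytope {x : T.V → ℝ} (hx : x ∈ T.fundamentalCone) :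
    ∃ a : ℝ, 0 < a ∧ a • x ∈ T.fundamentalPolytope := by
  have hpos : 0 < (1 + ∑ v, |x v|)⁻¹ := by positivity
  refine ⟨_, hpos, Set.mem_iInter.2 fun c => mem_convexHull_localCode
    ((T.localCone c).smul_mem hpos (T.mem_fundamentalCone.1 hx c)) ?_⟩
  simp only [Pi.smul_apply, smul_eq_mul, ← mul_sum]
  rw [inv_mul_le_iff₀ (by positivity), mul_one]
  linarith [sum_le_sum fun v (_ : v ∈ univ) => le_abs_self (x v)]

end Polytope

section LPSuccess

variable (T : TannerGraph) (η : T.V → Bool)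

theorem abs_llr (v : T.V) : |T.llr η v| = 1 := by
  unfold llr
  split_ifs <;> simp

@[simp]
theorem lpCost_zero : T.lpCost η 0 = 0 := by
  simp [lpCost]

theorem lpCost_smul (a : ℝ) (x : T.V → ℝ) : T.lpCost η (a • x) = a * T.lpCost η x := by
  simp only [lpCost, mul_sum, Pi.smul_apply, smul_eq_mul, mul_left_comm]

theorem abs_lpCost_sub_lpCost_le (x y : T.V → ℝ) :
    |T.lpCost η x - T.lpCost η y| ≤ ∑ v, |x v - y v| := by
  simp only [lpCost, ← sum_sub_distrib, ← mul_sub]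
  refine (abs_sum_le_sum_abs _ _).trans_eq (sum_congr rfl fun v _ => ?_)
  rw [abs_mul, abs_llr, one_mul]

theorem lpSuccess_iff_forall_mem_fundamentalPolytope :
    T.LPSuccess η ↔ ∀ x ∈ T.fundamentalPolytope, x ≠ 0 → 0 < T.lpCost η x := by
  constructor
  · intro h x hx hne
    have hmin : IsMinOn (T.lpCost η) T.fundamentalPolytope 0 := (h.ge rfl).2
    by_contra! hle
    refine hne (h.le ⟨hx, fun y hy => hle.trans ?_⟩)
    simpa using hmin hy
  · intro h
    refine Set.Subset.antisymm (fun x hx => ?_) ?_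
    · by_contra hne
      exact (h x hx.1 hne).not_ge ((hx.2 T.zero_mem_fundamentalPolytope).trans_eq (T.lpCost_zero η))
    · rintro _ rfl
      refine ⟨T.zero_mem_fundamentalPolytope, fun y hy => (T.lpCost_zero η).trans_le ?_⟩
      rcases eq_or_ne y 0 with rfl | hne
      exacts [(T.lpCost_zero η).ge, (h y hy hne).le]

theorem lpSuccess_iff_forall_mem_fundamentalCone :
    T.LPSuccess η ↔ ∀ x ∈ T.fundamentalCone, x ≠ 0 → 0 < T.lpCost η x := by
  rw [lpSuccess_iff_forall_mem_fundamentalPolytope]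
  refine ⟨fun h x hx hne => ?_, fun h x hx =>
    h x (T.fundamentalPolytope_subset_fundamentalCone hx)⟩
  obtain ⟨a, ha, hax⟩ := exists_pos_smul_mem_fundamentalPolytope hx
  refine pos_of_mul_pos_right ?_ ha.le
  rw [← lpCost_smul]
  exact h _ hax (smul_ne_zero ha.ne' hne)

end LPSuccess

/-- The Tanner graph in which the variable nodes that do not satisfy `p` are removed together with
their edges; all check nodes stay. -/
abbrev restrict (T : TannerGraph) (p : T.V → Prop) [DecidablePred p] : TannerGraph where
  V := {v // p v}
  C := T.C
  nbr c := (T.nbr c).subtype p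

section Restrict

variable {T : TannerGraph} {p : T.V → Prop} [DecidablePred p] {x : T.V → ℝ}

theorem sum_restrict_nbr (hx : ∀ v, ¬ p v → x v = 0) (c : T.C) :
    ∑ v ∈ (T.restrict p).nbr c, x v.1 = ∑ v ∈ T.nbr c, x v := by
  rw [sum_subtype_eq_sum_filter, sum_filter_of_ne fun v _ hv => not_imp_comm.1 (hx v) hv]

theorem comp_val_mem_fundamentalCone_restrict_iff (hx : ∀ v, ¬ p v → x v = 0) :
    (fun v => x v.1) ∈ (T.restrict p).fundamentalCone ↔ x ∈ T.fundamentalCone := by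
  rw [mem_fundamentalCone, mem_fundamentalCone]
  refine forall_congr' fun c => ?_
  rw [mem_localCone, mem_localCone, sum_restrict_nbr hx]
  constructor
  · rintro ⟨hnonneg, hcheck⟩
    have hnonneg' : ∀ v, 0 ≤ x v := fun v =>
      if hv : p v then hnonneg ⟨v, hv⟩ else (hx v hv).ge
    refine ⟨hnonneg', fun v hmem => ?_⟩
    by_cases hv : p v
    · exact hcheck ⟨v, hv⟩ (mem_subtype.2 hmem)
    · rw [hx v hv, mul_zero]
      exact sum_nonneg fun u _ => hnonneg' u
  · rintro ⟨hnonneg, hcheck⟩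
    exact ⟨fun v => hnonneg v, fun v hmem => hcheck v (mem_subtype.1 hmem)⟩

theorem lpCost_restrict (hx : ∀ v, ¬ p v → x v = 0) (η : T.V → Bool) :
    (T.restrict p).lpCost (fun v => η v.1) (fun v => x v.1) = T.lpCost η x := by
  have hremoved : ∑ v : {v // ¬ p v}, T.llr η v * x v = 0 :=
    sum_eq_zero fun v _ => by rw [hx v v.2, mul_zero]
  have hsplit := Fintype.sum_subtype_add_sum_subtype p fun v => T.llr η v * x v
  rwa [hremoved, add_zero] at hsplit

theorem restrict_lpSuccess_iff {η : T.V → Bool} :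
    (T.restrict p).LPSuccess (fun v => η v.1) ↔
      ∀ x ∈ T.fundamentalCone, (∀ v, ¬ p v → x v = 0) → x ≠ 0 → 0 < T.lpCost η x := by
  rw [lpSuccess_iff_forall_mem_fundamentalCone]
  constructor
  · intro h x hcone hx hne
    rw [← lpCost_restrict hx]
    refine h _ ((comp_val_mem_fundamentalCone_restrict_iff hx).2 hcone) fun hzero => hne ?_
    funext v
    by_cases hv : p v
    exacts [congrFun hzero ⟨v, hv⟩, hx v hv]
  · intro h y hcone hne
    obtain ⟨x, hx, rfl⟩ : ∃ x : T.V → ℝ, (∀ v, ¬ p v → x v = 0) ∧ (fun v => x v.1) = y :=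
      ⟨fun v => if hv : p v then y ⟨v, hv⟩ else 0, fun v hv => dif_neg hv,
        funext fun v => dif_pos v.2⟩
    rw [lpCost_restrict hx]
    refine h x ((comp_val_mem_fundamentalCone_restrict_iff hx).1 hcone) hx fun hzero => hne ?_
    simp only [hzero, Pi.zero_apply]
    rfl

theorem LPSuccess.restrict {η : T.V → Bool} (h : T.LPSuccess η) :
    (T.restrict p).LPSuccess (fun v => η v.1) :=
  restrict_lpSuccess_iff.2 fun x hx _ hne =>
    (T.lpSuccess_iff_forall_mem_fundamentalCone η).1 h x hx hne

end Restrict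

/-- A set `B` of variable nodes surrounds the removed nodes, those that do not satisfy `p`, in such
a way that every check node that loses a neighbor has all its neighbors in `B`, while a remaining
node in `B` is never the only such neighbor of a check node. Giving all remaining nodes of `B` the
same large weight then satisfies every check node, see `TannerGraph.flatten`. -/
structure IsBuffer (T : TannerGraph) (p : T.V → Prop) (B : Finset T.V) : Prop where
  mem_of_not : ∀ v, ¬ p v → v ∈ B
  nbr_subset : ∀ c, ∀ v ∈ T.nbr c, ¬ p v → T.nbr c ⊆ B
  exists_twin : ∀ c, ∀ v ∈ T.nbr c, v ∈ B → p v → ∃ u ∈ T.nbr c, u ≠ v ∧ u ∈ B ∧ p u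

open Classical in
/-- The vector `x` changed on `B` only: zero at the nodes of `B` that do not satisfy `p`, and the
total weight of `x` on `B` at each of the others. -/
noncomputable def flatten (T : TannerGraph) (p : T.V → Prop) (B : Finset T.V) (x : T.V → ℝ) :
    T.V → ℝ :=
  fun v => if v ∈ B then if p v then ∑ u ∈ B, x u else 0 else x v

section Flatten

variable {T : TannerGraph} {p : T.V → Prop} {B : Finset T.V} {x : T.V → ℝ}

theorem IsBuffer.flatten_eq_zero (hB : T.IsBuffer p B) {v : T.V} (hv : ¬ p v) :
    T.flatten p B x v = 0 := by
  rw [flatten, if_pos (hB.mem_of_not v hv), if_neg hv]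

theorem flatten_nonneg (hx : ∀ v, 0 ≤ x v) (v : T.V) : 0 ≤ T.flatten p B x v := by
  unfold flatten
  split_ifs
  exacts [sum_nonneg fun u _ => hx u, le_rfl, hx v]

theorem le_flatten (hx : ∀ v, 0 ≤ x v) {v : T.V} (hv : p v) : x v ≤ T.flatten p B x v := by
  unfold flatten
  split_ifs with hmem
  exacts [single_le_sum (fun u _ => hx u) hmem, le_rfl]

theorem IsBuffer.flatten_mem_fundamentalCone [Nonempty T.C] (hB : T.IsBuffer p B)
    (hx : x ∈ T.fundamentalCone) : T.flatten p B x ∈ T.fundamentalCone := by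
  classical
  have hx0 := nonneg_of_mem_fundamentalCone hx
  refine T.mem_fundamentalCone.2 fun c => ⟨flatten_nonneg hx0, fun v hv => ?_⟩
  by_cases hp : p v
  swap
  · rw [hB.flatten_eq_zero hp, mul_zero]
    exact sum_nonneg fun u _ => flatten_nonneg hx0 u
  by_cases hvB : v ∈ B
  · obtain ⟨u, hu, huv, huB, hup⟩ := hB.exists_twin c v hv hvB hp
    have heq : T.flatten p B x u = T.flatten p B x v := by
      simp only [flatten, huB, hvB, hup, hp, if_true]
    calc 2 * T.flatten p B x v = ∑ w ∈ {u, v}, T.flatten p B x w := by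
          rw [sum_pair huv, heq, two_mul]
      _ ≤ ∑ w ∈ T.nbr c, T.flatten p B x w :=
          sum_le_sum_of_subset_of_nonneg (by simp [insert_subset_iff, hu, hv])
            fun w _ _ => flatten_nonneg hx0 w
  · have hkept : ∀ u ∈ T.nbr c, p u := fun u hu =>
      by_contra fun hup => hvB (hB.nbr_subset c u hu hup hv)
    calc 2 * T.flatten p B x v = 2 * x v := by rw [flatten, if_neg hvB]
      _ ≤ ∑ u ∈ T.nbr c, x u := (T.mem_fundamentalCone.1 hx c).2 v hv
      _ ≤ ∑ u ∈ T.nbr c, T.flatten p B x u := sum_le_sum fun u hu => le_flatten hx0 (hkept u hu)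

theorem sum_abs_sub_flatten_le (hx : ∀ v, 0 ≤ x v) :
    ∑ v, |x v - T.flatten p B x v| ≤ #B * ∑ v ∈ B, x v := by
  have houtside : ∀ v ∈ univ, v ∉ B → |x v - T.flatten p B x v| = 0 := fun v _ hv => by
    rw [flatten, if_neg hv, sub_self, abs_zero]
  rw [← sum_subset (subset_univ B) houtside, ← nsmul_eq_mul]
  refine sum_le_card_nsmul B _ _ fun v hv => ?_
  have hle : x v ≤ ∑ u ∈ B, x u := single_le_sum (fun u _ => hx u) hv
  rw [flatten, if_pos hv]
  split_ifs
  · rw [abs_sub_comm, abs_of_nonneg (sub_nonneg.2 hle)]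
    linarith [hx v]
  · rwa [sub_zero, abs_of_nonneg (hx v)]

theorem neg_sum_le_lpCost (hx : ∀ v, 0 ≤ x v) (η : T.V → Bool) :
    -∑ v, x v ≤ T.lpCost η x := by
  simpa [abs_of_nonneg (hx _)] using neg_le_of_abs_le (T.abs_lpCost_sub_lpCost_le η x 0)

theorem IsBuffer.neg_card_mul_sum_le_lpCost [Nonempty T.C] [DecidablePred p]
    (hB : T.IsBuffer p B) (hx : x ∈ T.fundamentalCone) {η : T.V → Bool}
    (h : (T.restrict p).LPSuccess fun v => η v.1) : -(#B * ∑ v ∈ B, x v) ≤ T.lpCost η x := by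
  have hflat : 0 ≤ T.lpCost η (T.flatten p B x) := by
    rcases eq_or_ne (T.flatten p B x) 0 with hzero | hne
    · rw [hzero, lpCost_zero]
    · exact (restrict_lpSuccess_iff.1 h _ (hB.flatten_mem_fundamentalCone hx)
        (fun v hv => hB.flatten_eq_zero hv) hne).le
  have hclose := neg_le_of_abs_le (T.abs_lpCost_sub_lpCost_le η x (T.flatten p B x))
  linarith [sum_abs_sub_flatten_le (p := p) (B := B) (nonneg_of_mem_fundamentalCone hx)]

end Flatten

open Classical in
/-- The indicator of LP decoding failure, as a function of the error pattern. -/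
noncomputable def lpError (T : TannerGraph) (η : T.V → Bool) : ℝ :=
  if T.LPSuccess η then 0 else 1

section LPError

variable {T : TannerGraph}

theorem lpError_nonneg (η : T.V → Bool) : 0 ≤ T.lpError η := by
  unfold lpError
  split_ifs <;> norm_num

theorem lpErrorProb_eq_bscExp (ε : ℝ) : T.lpErrorProb ε = bscExp ε T.lpError := by
  refine sum_congr rfl fun η _ => ?_
  rw [lpError]
  split_ifs <;> simp

theorem lpErrorProb_nonneg {ε : ℝ} (h0 : 0 ≤ ε) (h1 : ε ≤ 1) : 0 ≤ T.lpErrorProb ε := by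
  rw [lpErrorProb_eq_bscExp, ← bscExp_const (V := T.V) ε 0]
  exact bscExp_mono h0 h1 lpError_nonneg

theorem lpErrorProb_restrict (p : T.V → Prop) [DecidablePred p] (ε : ℝ) :
    (T.restrict p).lpErrorProb ε = bscExp ε fun η => (T.restrict p).lpError fun v => η v.1 := by
  rw [lpErrorProb_eq_bscExp]
  exact (bscExp_comp_subtype_val ε p _).symm

theorem lpErrorProb_restrict_le (p : T.V → Prop) [DecidablePred p] {ε : ℝ} (h0 : 0 ≤ ε)
    (h1 : ε ≤ 1) : (T.restrict p).lpErrorProb ε ≤ T.lpErrorProb ε := by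
  rw [lpErrorProb_restrict, lpErrorProb_eq_bscExp]
  refine bscExp_mono h0 h1 fun η => ?_
  by_cases h : T.LPSuccess η
  · rw [lpError, if_pos h.restrict]
    exact lpError_nonneg η
  · rw [lpError, lpError, if_neg h]
    split_ifs <;> norm_num

theorem bscExp_lpCost_or (β : ℝ) (η : T.V → Bool) (x : T.V → ℝ) :
    bscExp β (fun ω => T.lpCost (fun v => η v || ω v) x) =
      (1 - β) * T.lpCost η x - β * ∑ v, x v := by
  simp only [lpCost, bscExp_sum, bscExp_mul_const, mul_sum, ← sum_sub_distrib]
  refine sum_congr rfl fun v _ => ?_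
  rw [← mul_assoc, ← sub_mul]
  refine congrArg (· * x v) ((bscExp_apply β v fun b => if η v || b then (-1 : ℝ) else 1).trans ?_)
  cases h : η v <;> simp [llr, h] <;> ring

end LPError

section BufferFamily

variable {T : TannerGraph} [Nonempty T.C] {ι : Type*} [Fintype ι] [Nonempty ι]
  {p : ι → T.V → Prop} [∀ i, DecidablePred (p i)] {B : ι → Finset T.V} {b m : ℕ}

theorem neg_mul_sum_le_lpCost (hB : ∀ i, T.IsBuffer (p i) (B i)) (hb : ∀ i, #(B i) ≤ b)
    (hm : ∀ v, {i | v ∈ B i}.ncard ≤ m) (η : T.V → Bool) {x : T.V → ℝ}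
    (hx : x ∈ T.fundamentalCone) :
    -((𝔼 i, (T.restrict (p i)).lpError fun v => η v.1) + b * m / Fintype.card ι) * ∑ v, x v ≤
      T.lpCost η x := by
  have hx0 := nonneg_of_mem_fundamentalCone hx
  have hbuffer0 : ∀ i, 0 ≤ ∑ v ∈ B i, x v := fun i => sum_nonneg fun v _ => hx0 v
  have hsingle : ∀ i, -((T.restrict (p i)).lpError fun v => η v.1) * ∑ v, x v -
      b * ∑ v ∈ B i, x v ≤ T.lpCost η x := by
    intro i
    rw [lpError]
    split_ifs with h
    · have hcost := (hB i).neg_card_mul_sum_le_lpCost hx h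
      have hcard : (#(B i) : ℝ) * ∑ v ∈ B i, x v ≤ b * ∑ v ∈ B i, x v :=
        mul_le_mul_of_nonneg_right (mod_cast hb i) (hbuffer0 i)
      linarith
    · have hcost := neg_sum_le_lpCost hx0 η
      have : 0 ≤ b * ∑ v ∈ B i, x v := mul_nonneg b.cast_nonneg (hbuffer0 i)
      linarith
  have haverage := expect_le_expect fun i (_ : i ∈ univ) => hsingle i
  rw [expect_sub_distrib, ← expect_mul, ← mul_expect, expect_neg_distrib,
    expect_const univ_nonempty, expect_eq_sum_div_card (s := univ) (f := fun i => ∑ v ∈ B i, x v),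
    card_univ] at haverage
  have hbuffers : b * ((∑ i, ∑ v ∈ B i, x v) / Fintype.card ι) ≤
      b * (m * (∑ v, x v) / Fintype.card ι) := by
    gcongr
    exact sum_sum_le_mul_sum hx0 hm
  refine le_trans (le_of_eq ?_) ((sub_le_sub_left hbuffers _).trans haverage)
  ring

theorem sub_mul_sum_le_lpCost (hB : ∀ i, T.IsBuffer (p i) (B i)) (hb : ∀ i, #(B i) ≤ b)
    (hm : ∀ v, {i | v ∈ B i}.ncard ≤ m) {β : ℝ} (h0 : 0 ≤ β) (h1 : β ≤ 1) (η : T.V → Bool)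
    {x : T.V → ℝ} (hx : x ∈ T.fundamentalCone) :
    (β - b * m / Fintype.card ι -
        bscExp β fun ω => 𝔼 i, (T.restrict (p i)).lpError fun v => η v.1 || ω v.1) * ∑ v, x v ≤
      (1 - β) * T.lpCost η x := by
  have hmean := bscExp_mono h0 h1 fun ω : T.V → Bool =>
    neg_mul_sum_le_lpCost hB hb hm (fun v => η v || ω v) hx
  simp only [neg_mul_comm, bscExp_mul_const, bscExp_add, bscExp_const, bscExp_lpCost_or] at hmean
  linarith

theorem lpError_mul_le (hB : ∀ i, T.IsBuffer (p i) (B i)) (hb : ∀ i, #(B i) ≤ b)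
    (hm : ∀ v, {i | v ∈ B i}.ncard ≤ m) {β : ℝ} (h0 : 0 ≤ β) (h1 : β ≤ 1) (η : T.V → Bool) :
    T.lpError η * (β - b * m / Fintype.card ι) ≤
      bscExp β fun ω => 𝔼 i, (T.restrict (p i)).lpError fun v => η v.1 || ω v.1 := by
  by_cases h : T.LPSuccess η
  · rw [lpError, if_pos h, zero_mul, ← bscExp_const (V := T.V) β 0]
    exact bscExp_mono h0 h1 fun ω => expect_nonneg fun i _ => lpError_nonneg _
  · rw [lpError, if_neg h, one_mul]
    rw [lpSuccess_iff_forall_mem_fundamentalCone] at h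
    push Not at h
    obtain ⟨x, hx, hne, hcost⟩ := h
    have hpos : 0 < ∑ v, x v :=
      Fintype.sum_pos (lt_of_le_of_ne' (nonneg_of_mem_fundamentalCone hx) hne)
    have hle := (sub_mul_sum_le_lpCost hB hb hm h0 h1 η hx).trans
      (mul_nonpos_of_nonneg_of_nonpos (sub_nonneg.2 h1) hcost)
    exact sub_nonpos.1 (nonpos_of_mul_nonpos_left hle hpos)

theorem lpErrorProb_mul_le (hB : ∀ i, T.IsBuffer (p i) (B i)) (hb : ∀ i, #(B i) ≤ b)
    (hm : ∀ v, {i | v ∈ B i}.ncard ≤ m) {ε β : ℝ} (hε0 : 0 ≤ ε) (hε1 : ε ≤ 1) (hβ0 : 0 ≤ β)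
    (hβ1 : β ≤ 1) :
    T.lpErrorProb ε * (β - b * m / Fintype.card ι) ≤
      𝔼 i, (T.restrict (p i)).lpErrorProb (ε + (1 - ε) * β) := by
  simp only [lpErrorProb_restrict]
  rw [lpErrorProb_eq_bscExp, ← bscExp_mul_const, ← bscExp_expect, ← bscExp_bscExp_or]
  exact bscExp_mono hε0 hε1 (lpError_mul_le hB hb hm hβ0 hβ1)

end BufferFamily

end TannerGraph

namespace GraphCoverCode

variable {dv k L M : ℕ}

/-- The variable node `v` is not removed by the cut at position `i`. -/
abbrev IsKept (dv : ℕ) (i : ZMod (2 * L + 1)) (v : ZMod (2 * L + 1) × Fin M) : Prop :=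
  ∀ j ∈ range (2 * ((dv - 1) / 2)), v.1 ≠ i + (j : ZMod (2 * L + 1))

/-- The variable nodes at the positions that share the window of a check node with one of the
positions `i, …, i + 2h - 1` removed by the cut at `i`, where `h = (dv - 1) / 2`. -/
noncomputable def zone (dv M : ℕ) (i : ZMod (2 * L + 1)) : Finset (ZMod (2 * L + 1) × Fin M) :=
  ((Ico (-(2 * ((dv - 1) / 2 : ℕ)) : ℤ) (4 * ((dv - 1) / 2 : ℕ))).image
    fun j : ℤ => i + (j : ZMod (2 * L + 1))) ×ˢ univ

theorem mem_zone {i : ZMod (2 * L + 1)} {v : ZMod (2 * L + 1) × Fin M} :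
    v ∈ zone dv M i ↔
      ∃ j ∈ Ico (-(2 * ((dv - 1) / 2 : ℕ)) : ℤ) (4 * ((dv - 1) / 2 : ℕ)),
        i + (j : ZMod (2 * L + 1)) = v.1 := by
  simp only [zone, mem_product, mem_image, mem_univ, and_true]

theorem card_zone_le (i : ZMod (2 * L + 1)) : #(zone dv M i) ≤ 3 * dv * M := by
  rw [zone, card_product, card_univ, Fintype.card_fin]
  refine Nat.mul_le_mul_right M (card_image_le.trans ?_)
  rw [Int.card_Ico]
  omega

theorem ncard_setOf_mem_zone_le (v : ZMod (2 * L + 1) × Fin M) :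
    {i | v ∈ zone dv M i}.ncard ≤ 3 * dv := by
  have hsub : {i | v ∈ zone dv M i} ⊆
      (Ico (-(2 * ((dv - 1) / 2 : ℕ)) : ℤ) (4 * ((dv - 1) / 2 : ℕ))).image
        fun j : ℤ => v.1 - (j : ZMod (2 * L + 1)) := by
    intro i hi
    obtain ⟨j, hj, hv⟩ := mem_zone.1 hi
    exact mem_coe.2 (mem_image.2 ⟨j, hj, sub_eq_of_eq_add hv.symm⟩)
  refine (Set.ncard_le_ncard hsub).trans ?_
  rw [Set.ncard_coe_finset]
  refine card_image_le.trans ?_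
  rw [Int.card_Ico]
  omega

theorem isBuffer_zone (ζ : GraphCoverCode dv k L M) (hk : 2 ≤ k) (i : ZMod (2 * L + 1)) :
    ζ.toTanner.IsBuffer (IsKept dv i) (zone dv M i) where
  mem_of_not v hv := by
    unfold IsKept at hv
    push Not at hv
    obtain ⟨j, hj, hvj⟩ := hv
    refine mem_zone.2 ⟨j, ?_, by rw [hvj, Int.cast_natCast]⟩
    simp only [mem_range, mem_Ico] at hj ⊢
    omega
  nbr_subset c v hv hcut u hu := by
    unfold IsKept at hcut
    push Not at hcut
    obtain ⟨j, hj, hvj⟩ := hcut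
    obtain ⟨a, ha, hva⟩ := ζ.window c v hv
    obtain ⟨b, hb, hub⟩ := ζ.window c u hu
    refine mem_zone.2 ⟨j + b - a, ?_, ?_⟩
    · simp only [mem_range, mem_Icc, mem_Ico] at hj ha hb ⊢
      omega
    · push_cast
      linear_combination hva - hvj - hub
  exists_twin c v hv hzone hkept := by
    obtain ⟨a, ha, hva⟩ := ζ.window c v hv
    obtain ⟨u, hu, huv⟩ := exists_mem_ne ((ζ.card_window c a ha).symm ▸ hk) v
    obtain ⟨huc, hua⟩ := mem_filter.1 hu
    have hpos : u.1 = v.1 := hua.trans hva.symm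
    exact ⟨u, huc, huv, mem_zone.2 (hpos ▸ mem_zone.1 hzone), fun j hj => hpos ▸ hkept j hj⟩

theorem nonempty_checks (ζ : GraphCoverCode dv k L M) (hM : 0 < M / k) :
    Nonempty ζ.toTanner.C :=
  ⟨((0 : ZMod (2 * L + 1)), (⟨0, hM⟩ : Fin (M / k)))⟩

theorem lpErrorProb_toTanner_mul_le (ζ : GraphCoverCode dv k L M) (hk : 2 ≤ k) (hM : 0 < M / k)
    {ε β : ℝ} (hε0 : 0 ≤ ε) (hε1 : ε ≤ 1) (hβ0 : 0 ≤ β) (hβ1 : β ≤ 1) :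
    ζ.toTanner.lpErrorProb ε * (β - (3 * dv) ^ 2 * M / (2 * L + 1)) ≤
      𝔼 i, (ζ.cut i).lpErrorProb (ε + (1 - ε) * β) := by
  have := ζ.nonempty_checks hM
  have hloss : ((3 * dv * M : ℕ) * (3 * dv : ℕ) / Fintype.card (ZMod (2 * L + 1)) : ℝ) =
      (3 * dv) ^ 2 * M / (2 * L + 1) := by
    rw [ZMod.card]
    push_cast
    ring
  have hmul := TannerGraph.lpErrorProb_mul_le (T := ζ.toTanner) (p := fun i => IsKept dv i)
    (ζ.isBuffer_zone hk) card_zone_le ncard_setOf_mem_zone_le hε0 hε1 hβ0 hβ1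
  rwa [hloss] at hmul

theorem lpErrorProb_cut_le (ζ : GraphCoverCode dv k L M) (i : ZMod (2 * L + 1)) {ε : ℝ}
    (h0 : 0 ≤ ε) (h1 : ε ≤ 1) : (ζ.cut i).lpErrorProb ε ≤ ζ.toTanner.lpErrorProb ε :=
  TannerGraph.lpErrorProb_restrict_le (T := ζ.toTanner) (IsKept dv i) h0 h1

end GraphCoverCode

section Ensemble

variable {dv k L M : ℕ}

noncomputable instance : Fintype (GraphCoverCode dv k L M) :=
  Fintype.ofInjective GraphCoverCode.nbr fun ζ ξ h => by
    cases ζ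
    cases ξ
    congr

theorem ensembleErrorProb_coverEnsemble (Γ : PMF (GraphCoverCode dv k L M)) (ε : ℝ) :
    ensembleErrorProb (coverEnsemble Γ) ε = ∑ ζ, (Γ ζ).toReal * ζ.toTanner.lpErrorProb ε :=
  (hasSum_toReal_map_mul Γ _ _).tsum_eq

theorem ensembleErrorProb_coupledEnsemble (Γ : PMF (GraphCoverCode dv k L M)) (ε : ℝ) :
    ensembleErrorProb (coupledEnsemble Γ) ε =
      ∑ ζ, (Γ ζ).toReal * 𝔼 i, (ζ.cut i).lpErrorProb ε := by
  refine (hasSum_toReal_bind_mul Γ fun ζ => ?_).tsum_eq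
  convert hasSum_toReal_map_mul (PMF.uniformOfFintype (ZMod (2 * L + 1))) ζ.cut
    (fun T => T.lpErrorProb ε) using 1
  simp only [PMF.uniformOfFintype_apply, ENNReal.toReal_inv, ENNReal.toReal_natCast, ← mul_sum,
    expect_eq_sum_div_card, card_univ, div_eq_inv_mul]

theorem ensembleErrorProb_nonneg (Γ : PMF TannerGraph) {ε : ℝ} (h0 : 0 ≤ ε) (h1 : ε ≤ 1) :
    0 ≤ ensembleErrorProb Γ ε :=
  tsum_nonneg fun _ => mul_nonneg ENNReal.toReal_nonneg (TannerGraph.lpErrorProb_nonneg h0 h1)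

theorem ensembleErrorProb_coupledEnsemble_le (Γ : PMF (GraphCoverCode dv k L M)) {ε : ℝ}
    (h0 : 0 ≤ ε) (h1 : ε ≤ 1) :
    ensembleErrorProb (coupledEnsemble Γ) ε ≤ ensembleErrorProb (coverEnsemble Γ) ε := by
  rw [ensembleErrorProb_coverEnsemble, ensembleErrorProb_coupledEnsemble]
  exact sum_le_sum fun ζ _ => mul_le_mul_of_nonneg_left
    (expect_le univ_nonempty fun i _ => ζ.lpErrorProb_cut_le i h0 h1) ENNReal.toReal_nonneg

theorem ensembleErrorProb_coverEnsemble_mul_le (hk : 2 ≤ k) (hM : 0 < M / k)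
    (Γ : PMF (GraphCoverCode dv k L M)) {ε β : ℝ} (hε0 : 0 ≤ ε) (hε1 : ε ≤ 1) (hβ0 : 0 ≤ β)
    (hβ1 : β ≤ 1) :
    ensembleErrorProb (coverEnsemble Γ) ε * (β - (3 * dv) ^ 2 * M / (2 * L + 1)) ≤
      ensembleErrorProb (coupledEnsemble Γ) (ε + (1 - ε) * β) := by
  rw [ensembleErrorProb_coverEnsemble, ensembleErrorProb_coupledEnsemble, sum_mul]
  refine sum_le_sum fun ζ _ => ?_
  rw [mul_assoc]
  exact mul_le_mul_of_nonneg_left (ζ.lpErrorProb_toTanner_mul_le hk hM hε0 hε1 hβ0 hβ1)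
    ENNReal.toReal_nonneg

theorem tendsto_coupledEnsemble_of_coverEnsemble {L M : ℕ → ℕ}
    (Γ : ∀ t, PMF (GraphCoverCode dv k (L t) (M t))) {ε : ℝ} (h0 : 0 ≤ ε) (h1 : ε ≤ 1)
    (h : Tendsto (fun t => ensembleErrorProb (coverEnsemble (Γ t)) ε) atTop (𝓝 0)) :
    Tendsto (fun t => ensembleErrorProb (coupledEnsemble (Γ t)) ε) atTop (𝓝 0) :=
  squeeze_zero (fun _ => ensembleErrorProb_nonneg _ h0 h1)
    (fun t => ensembleErrorProb_coupledEnsemble_le (Γ t) h0 h1) h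

theorem tendsto_mul_div_two_mul_add_one_zero {L M : ℕ → ℕ}
    (hML : (fun t => (M t : ℝ)) =o[atTop] fun t => (L t : ℝ)) (a : ℝ) :
    Tendsto (fun t => a * M t / (2 * L t + 1)) atTop (𝓝 0) := by
  have hL : (fun t => (L t : ℝ)) =O[atTop] fun t => 2 * (L t : ℝ) + 1 :=
    .of_norm_le fun t => by
      rw [Real.norm_natCast]
      linarith [(L t).cast_nonneg (α := ℝ)]
  exact ((hML.trans_isBigO hL).const_mul_left a).tendsto_div_nhds_zero

theorem tendsto_coverEnsemble_of_coupledEnsemble (hk : 2 ≤ k) {L M : ℕ → ℕ}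
    (Γ : ∀ t, PMF (GraphCoverCode dv k (L t) (M t))) (hM : ∀ t, 0 < M t / k)
    (hML : (fun t => (M t : ℝ)) =o[atTop] fun t => (L t : ℝ)) {ε ε' : ℝ}
    (h0 : 0 ≤ ε) (hlt : ε < ε') (h1 : ε' ≤ 1)
    (h : Tendsto (fun t => ensembleErrorProb (coupledEnsemble (Γ t)) ε') atTop (𝓝 0)) :
    Tendsto (fun t => ensembleErrorProb (coverEnsemble (Γ t)) ε) atTop (𝓝 0) := by
  have hd : 0 < 1 - ε := by linarith
  obtain ⟨β, hβ0, hβ1, rfl⟩ : ∃ β, 0 < β ∧ β ≤ 1 ∧ ε + (1 - ε) * β = ε' :=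
    ⟨(ε' - ε) / (1 - ε), div_pos (sub_pos.2 hlt) hd, (div_le_one hd).2 (by linarith),
      by rw [mul_div_cancel₀ _ hd.ne', add_sub_cancel]⟩
  have hgap : Tendsto (fun t => β - (3 * dv) ^ 2 * M t / (2 * L t + 1)) atTop (𝓝 β) := by
    simpa using (tendsto_mul_div_two_mul_add_one_zero hML ((3 * dv) ^ 2)).const_sub β
  have hbound : ∀ᶠ t in atTop, ensembleErrorProb (coverEnsemble (Γ t)) ε ≤
      ensembleErrorProb (coupledEnsemble (Γ t)) (ε + (1 - ε) * β) /
        (β - (3 * dv) ^ 2 * M t / (2 * L t + 1)) := by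
    filter_upwards [hgap.eventually_const_lt hβ0] with t ht
    rw [le_div_iff₀ ht]
    exact ensembleErrorProb_coverEnsemble_mul_le hk (hM t) (Γ t) h0 (by linarith) hβ0.le hβ1
  refine squeeze_zero' (.of_forall fun t => ensembleErrorProb_nonneg _ h0 (by linarith)) hbound ?_
  rw [← zero_div β]
  exact h.div hgap hβ0.ne'

end Ensemble

section Threshold

variable {G : ℕ → PMF TannerGraph}

theorem le_lpThreshold {ε : ℝ} (h0 : 0 < ε) (h1 : ε < 1 / 2)
    (h : Tendsto (fun t => ensembleErrorProb (G t) ε) atTop (𝓝 0)) : ε ≤ lpThreshold G :=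
  le_csSup ⟨1 / 2, fun _ h' => h'.2.1.le⟩ ⟨h0, h1, (Asymptotics.isLittleO_one_iff ℝ).2 h⟩

theorem lpThreshold_nonneg : 0 ≤ lpThreshold G :=
  Real.sSup_nonneg fun _ h => h.1.le

theorem lpThreshold_le {a : ℝ} (ha : 0 ≤ a)
    (h : ∀ ε, 0 < ε → ε < 1 / 2 → Tendsto (fun t => ensembleErrorProb (G t) ε) atTop (𝓝 0) →
      ε ≤ a) : lpThreshold G ≤ a :=
  Real.sSup_le (fun ε hε => h ε hε.1 hε.2.1 ((Asymptotics.isLittleO_one_iff ℝ).1 hε.2.2)) ha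

end Threshold

theorem mainTheorem1_general {dv k : ℕ} (hk : 2 ≤ k) {L M : ℕ → ℕ}
    (Γ : ∀ t, PMF (GraphCoverCode dv k (L t) (M t))) (hkM : ∀ t, k ≤ M t)
    (hML : (fun t => (M t : ℝ)) =o[atTop] fun t => (L t : ℝ)) :
    lpThreshold (fun t => coverEnsemble (Γ t)) = lpThreshold (fun t => coupledEnsemble (Γ t)) := by
  have hchecks : ∀ t, 0 < M t / k := fun t => Nat.div_pos (hkM t) (by omega)
  refine le_antisymm (lpThreshold_le lpThreshold_nonneg fun ε h0 h1 h => ?_)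
    (lpThreshold_le lpThreshold_nonneg fun ε _ h1 h => ?_)
  · exact le_lpThreshold h0 h1
      (tendsto_coupledEnsemble_of_coverEnsemble Γ h0.le (by linarith) h)
  · refine le_of_forall_lt_imp_le_of_dense fun a ha => ?_
    rcases le_or_gt a 0 with ha0 | ha0
    · exact ha0.trans lpThreshold_nonneg
    · exact le_lpThreshold ha0 (ha.trans h1)
        (tendsto_coverEnsemble_of_coupledEnsemble hk Γ hchecks hML ha0.le ha (by linarith) h)

theorem mainTheorem1 (dv k : ℕ) (hdv : 2 < dv) (hodd : Odd dv) (hk : 2 ≤ k) :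
    ∃ ν : ℝ, 0 < ν ∧
      ∀ (L M : ℕ → ℕ) (Γ : ∀ t, PMF (GraphCoverCode dv k (L t) (M t))),
        Filter.Tendsto L Filter.atTop Filter.atTop →
        (∀ t, 0 < M t) →
        (∀ t, k ∣ M t) →
        (fun t => (M t : ℝ)) =o[Filter.atTop] (fun t => (L t : ℝ) ^ ν) →
        (∀ Δ : ℝ, 0 < Δ → Δ < lpThreshold (fun t => coupledEnsemble (Γ t)) →
          (fun t => ensembleErrorProb (coupledEnsemble (Γ t))
              (lpThreshold (fun t => coupledEnsemble (Γ t)) - Δ))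
            =o[Filter.atTop] (fun t => 1 / (L t : ℝ) ^ 2)) →
        lpThreshold (fun t => coverEnsemble (Γ t)) =
          lpThreshold (fun t => coupledEnsemble (Γ t)) :=
  ⟨1, one_pos, fun L M Γ _ hM hkM hML _ =>
    mainTheorem1_general hk Γ (fun t => Nat.le_of_dvd (hM t) (hkM t))
      (by simpa only [Real.rpow_one] using hML)⟩
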